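/- For $\sigma\in S_3$ let $\mathrm{Av}_n(\sigma)$ be the set of permutations $\tau\in S_n$ that avoid $\sigma$, i.e. for which there are no indices $i_1<i_2<i_3$ such that, for all $1\le s<t\le 3$, $\tau(i_s)<\tau(i_t)$ if and only if $\sigma(s)<\sigma(t)$. Let $Z$ be distributed like the sum of two independent Geometric$(2/3)$ random variables, where Geometric$(2/3)$ has mass $\frac23\left(\frac13\right)^k$ at each $k\in\{0,1,2,\dots\}$; that is, $\mathbb{P}(Z=k)=\frac49(k+1)\left(\frac13\right)^k$ for $k\in\{0,1,2,\dots\}$. If, for each $n$, $\pi_n$ is a uniformly random element of $\mathrm{Av}_n(132)$, or if, for each $n$, $\pi_n$ is a uniformly random element of $\mathrm{Av}_n(213)$, then $$\sum_{i=1}^n \mathbf{1}_{\{\pi_n(i)=i\}}\ \overset{d}{\longrightarrow}\ Z\qquad (n\to\infty).$$ -/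

import Mathlib

open MeasureTheory ProbabilityTheory Filter

namespace PatternAvoidance

/-- `τ ∈ S_n` contains the pattern `σ ∈ S_k`: there are indices `i_1 < ⋯ < i_k` such that
`τ(i_s) < τ(i_t)` if and only if `σ(s) < σ(t)`, for all `s < t`. -/
def Contains {n k : ℕ} (τ : Equiv.Perm (Fin n)) (σ : Equiv.Perm (Fin k)) : Prop :=
  ∃ i : Fin k → Fin n, StrictMono i ∧ ∀ s t : Fin k, s < t → (τ (i s) < τ (i t) ↔ σ s < σ t)

/-- `Av_n(σ)`, the set of `σ`-avoiding permutations in `S_n`. -/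
def Av (n : ℕ) {k : ℕ} (σ : Equiv.Perm (Fin k)) : Set (Equiv.Perm (Fin n)) :=
  {τ | ¬ Contains τ σ}

/-- The pattern `132`; positions and values are numbered from `0`. -/
def p132 : Equiv.Perm (Fin 3) := Equiv.swap 1 2

/-- The pattern `213`; positions and values are numbered from `0`. -/
def p213 : Equiv.Perm (Fin 3) := Equiv.swap 0 1

theorem coe_p132 : ⇑p132 = ![0, 2, 1] := by decide

theorem coe_p213 : ⇑p213 = ![1, 0, 2] := by decide

/-- The number of fixed points of a permutation of `{1, …, n}`. -/
def numFixedPoints {n : ℕ} (τ : Equiv.Perm (Fin n)) : ℕ :=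
  ∑ i : Fin n, if τ i = i then 1 else 0

/-- The finite set `S_n` carries the discrete σ-algebra. -/
instance instMeasurableSpacePerm (n : ℕ) : MeasurableSpace (Equiv.Perm (Fin n)) := ⊤

/-- The law Geometric(2/3) on `{0, 1, 2, …}`, with mass `(2/3) (1/3) ^ k` at `k`. -/
noncomputable def geometricTwoThirds : Measure ℕ :=
  geometricMeasure ⟨2 / 3, by norm_num, by norm_num⟩

end PatternAvoidance

open PatternAvoidance

/-! The proof is the method of binomial moments, with exact moments at finite `n`. Let `c` be the
Catalan series and `C_n` its coefficients. The core identity is that the sum of `binom(fix τ, r)`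
over `Av_n(132)` is the coefficient of `x^n` in `x^r c^(r+1)`.

A 132-avoiding word is `s' n t`, where `s'` lies entirely above `t` and is a shifted avoiding word.
Shifting moves fixed points to other diagonals, so all diagonals `i - l i = d` are treated at once.
The generating functions `G_n(d) = ∑ (1+X)^(number of entries on diagonal d)` satisfy a quadratic
recurrence (`sum_avWords_succ`), and the solution is explicit: `G_n(d) = C_n + X ∑ C_(n-1-m) F_m`
over `m + 1 + |d| ≤ n`, with `F_m = G_m(0)`. It solves the recurrence because a diagonal meets at
most one of the two blocks, and the remaining coefficient identity is Catalan's own recurrence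
(`catalan_diagonal_convolution`).

From `c = 1 + x c^2`, the normalized moments are `(r+1) ∏_{j<r} (n-j)/(2n-j)`. They are at most
`(r+1)/2^r` and tend to it. Binomial inversion writes `P(fix = k)` as an alternating series in them,
and dominated convergence gives the limit `(4/9)(k+1)/3^k`. Reverse-complement carries 213 to 132
and preserves the number of fixed points. On `ℕ`, convergence of point masses to a probability mass
function gives convergence in distribution. -/

namespace PatternAvoidance

/-! ### Avoiding words and their decomposition at the maximum -/

open List in
/-- A word over `ℕ` avoids the pattern `132`. -/
def WordAvoids (l : List ℕ) : Prop :=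
  ∀ a b c, [a, b, c] <+ l → ¬ (a < c ∧ c < b)

open Classical in
/-- The `132`-avoiding rearrangements of the word `0, 1, …, n - 1`. -/
noncomputable def avWords (n : ℕ) : Finset (List ℕ) :=
  (List.range n).permutations.toFinset.filter WordAvoids

/-- The number of positions `i` of the word `l` with `i - l i = d`. -/
def diagCount : ℤ → List ℕ → ℕ
  | _, [] => 0
  | d, x :: l => (if -(x : ℤ) = d then 1 else 0) + diagCount (d - 1) l

theorem diagCount_append (d : ℤ) (s t : List ℕ) :
    diagCount d (s ++ t) = diagCount d s + diagCount (d - s.length) t := by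
  induction s generalizing d with
  | nil => simp [diagCount]
  | cons x s ih =>
    simp only [List.cons_append, diagCount, ih, List.length_cons, Nat.cast_add, Nat.cast_one]
    rw [show d - 1 - (s.length : ℤ) = d - (s.length + 1) by ring]
    ring

theorem diagCount_map_add (d : ℤ) (b : ℕ) (s : List ℕ) :
    diagCount d (s.map (· + b)) = diagCount (d + b) s := by
  induction s generalizing d with
  | nil => simp [diagCount]
  | cons x s ih =>
    simp only [List.map_cons, diagCount, ih]
    rw [show d - 1 + (b : ℤ) = d + b - 1 by ring]
    congr 1
    apply if_congr _ rfl rfl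
    push_cast
    constructor <;> intro h <;> linarith

theorem perm_range_iff {l : List ℕ} {n : ℕ} :
    l.Perm (List.range n) ↔ l.Nodup ∧ l.length = n ∧ ∀ x ∈ l, x < n := by
  constructor
  · intro h
    exact ⟨h.nodup_iff.2 List.nodup_range, by simpa using h.length_eq,
      fun x hx => by simpa using h.subset hx⟩
  · rintro ⟨h1, h2, h3⟩
    refine List.Subperm.perm_of_length_le ?_ (by simp [h2])
    exact List.subperm_of_subset h1 fun x hx => by simpa using h3 x hx

theorem mem_avWords {l : List ℕ} {n : ℕ} :
    l ∈ avWords n ↔ (l.Nodup ∧ l.length = n ∧ ∀ x ∈ l, x < n) ∧ WordAvoids l := by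
  simp [avWords, ← perm_range_iff]

theorem WordAvoids.sublist {l l' : List ℕ} (h : WordAvoids l) (hl : l'.Sublist l) :
    WordAvoids l' :=
  fun a b c habc => h a b c (habc.trans hl)

theorem wordAvoids_map_add {s : List ℕ} {b : ℕ} :
    WordAvoids (s.map (· + b)) ↔ WordAvoids s := by
  constructor
  · intro h x y z hs
    have := h _ _ _ (hs.map (· + b))
    simpa using this
  · intro h x y z hs
    obtain ⟨l, hl, he⟩ := List.sublist_map_iff.1 hs
    match l, he with
    | [x', y', z'], he =>
      simp only [List.map_cons, List.map_nil, List.cons.injEq, and_true] at he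
      obtain ⟨rfl, rfl, rfl⟩ := he
      simpa using h _ _ _ hl

theorem wordAvoids_append_cons {s t : List ℕ} {n : ℕ} (hs : WordAvoids s) (ht : WordAvoids t)
    (hsn : ∀ x ∈ s, x < n) (htn : ∀ x ∈ t, x < n) (hst : ∀ x ∈ s, ∀ y ∈ t, y < x) :
    WordAvoids (s ++ n :: t) := by
  intro x y z h hxyz
  obtain ⟨l₁, l₂, he, h1, h2⟩ := List.sublist_append_iff.1 h
  match l₁, he with
  | [], he =>
    simp only [List.nil_append] at he
    subst he
    rcases List.sublist_cons_iff.1 h2 with h2 | ⟨r, hr, h2⟩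
    · exact ht _ _ _ h2 hxyz
    · simp only [List.cons.injEq] at hr
      obtain ⟨rfl, rfl⟩ := hr
      have := htn z (h2.subset (by simp))
      omega
  | [x'], he =>
    simp only [List.cons_append, List.nil_append, List.cons.injEq] at he
    obtain ⟨rfl, rfl⟩ := he
    have hx := h1.subset (List.mem_singleton_self x)
    have hz : z ∈ t := by
      rcases List.sublist_cons_iff.1 h2 with h2 | ⟨r, hr, h2⟩
      · exact h2.subset (by simp)
      · simp only [List.cons.injEq] at hr
        obtain ⟨rfl, rfl⟩ := hr
        exact h2.subset (by simp)
    have := hst x hx z hz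
    omega
  | [x', y'], he =>
    simp only [List.cons_append, List.nil_append, List.cons.injEq] at he
    obtain ⟨rfl, rfl, rfl⟩ := he
    have hx : x ∈ s := h1.subset (by simp)
    have hy : y ∈ s := h1.subset (by simp)
    have hz : z ∈ n :: t := h2.subset (by simp)
    have := hsn y hy
    rcases List.mem_cons.1 hz with rfl | hz
    · omega
    · have := hst x hx z hz
      omega
  | x' :: y' :: z' :: r, he =>
    simp only [List.cons_append, List.cons.injEq] at he
    obtain ⟨rfl, rfl, rfl, he⟩ := he
    obtain ⟨rfl, -⟩ := List.append_eq_nil_iff.1 he.symm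
    exact hs _ _ _ h1 hxyz

theorem append_cons_mem_avWords {a b : ℕ} {s t : List ℕ} (hs : s ∈ avWords a)
    (ht : t ∈ avWords b) : s.map (· + b) ++ (a + b) :: t ∈ avWords (a + b + 1) := by
  rw [mem_avWords] at hs ht ⊢
  obtain ⟨⟨hs1, hs2, hs3⟩, hs4⟩ := hs
  obtain ⟨⟨ht1, ht2, ht3⟩, ht4⟩ := ht
  have hsn : ∀ x ∈ s.map (· + b), x < a + b ∧ b ≤ x := by
    intro x hx
    obtain ⟨y, hy, rfl⟩ := List.mem_map.1 hx
    have := hs3 y hy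
    omega
  refine ⟨⟨?_, by simp [hs2, ht2]; omega, ?_⟩, ?_⟩
  · rw [List.nodup_append]
    refine ⟨hs1.map (add_left_injective b), List.nodup_cons.2 ⟨?_, ht1⟩, ?_⟩
    · intro h
      have := ht3 _ h
      omega
    · intro x hx y hy
      have := hsn x hx
      rcases List.mem_cons.1 hy with rfl | hy
      · omega
      · have := ht3 y hy
        omega
  · intro x hx
    rcases List.mem_append.1 hx with hx | hx
    · have := hsn x hx
      omega
    · rcases List.mem_cons.1 hx with rfl | hx
      · omega
      · have := ht3 x hx
        omega
  · refine wordAvoids_append_cons (wordAvoids_map_add.2 hs4) ht4 (fun x hx => (hsn x hx).1)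
      (fun x hx => ?_) (fun x hx y hy => ?_)
    · have := ht3 x hx
      omega
    · have := ht3 y hy
      have := hsn x hx
      omega

theorem exists_of_mem_avWords {n : ℕ} {l : List ℕ} (hl : l ∈ avWords (n + 1)) :
    ∃ a b, a + b = n ∧ ∃ s ∈ avWords a, ∃ t ∈ avWords b, l = s.map (· + b) ++ n :: t := by
  rw [mem_avWords] at hl
  obtain ⟨hr, hav⟩ := hl
  have hp := perm_range_iff.2 hr
  obtain ⟨s, t, rfl⟩ := List.append_of_mem (hp.symm.subset (show n ∈ List.range (n + 1) by simp))
  have hp' : (s ++ t).Perm (List.range n) := by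
    refine List.Perm.cons_inv (a := n) (List.perm_middle.symm.trans (hp.trans ?_))
    rw [List.range_succ]
    exact List.perm_append_singleton _ _
  obtain ⟨hd, hlen, hlt⟩ := perm_range_iff.1 hp'
  obtain ⟨hds, hdt, hdst⟩ := List.nodup_append.1 hd
  have hst : ∀ x ∈ s, ∀ y ∈ t, y < x := by
    intro x hx y hy
    have h1 := hdst x hx y hy
    have h2 : y < n := hlt y (by simp [hy])
    -- With `n` between them, `x < y` would make `x n y` a 132 pattern.
    have h3 := hav x n y (List.Sublist.append (List.singleton_sublist.2 hx)
      (List.Sublist.cons_cons n (List.singleton_sublist.2 hy)))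
    omega
  -- Every value below an entry of `t` is again in `t`, so `t` is an initial segment of values and
  -- contains at least `y + 1` of them.
  have htb : ∀ y ∈ t, y < t.length := by
    intro y hy
    have hsub : List.range (y + 1) ⊆ t := by
      intro z hz
      rw [List.mem_range] at hz
      have h2 : y < n := hlt y (by simp [hy])
      rcases List.mem_append.1 (hp'.symm.subset (List.mem_range.2 (show z < n by omega)))
        with h | h
      · have := hst z h y hy
        omega
      · exact h
    have := (List.subperm_of_subset List.nodup_range hsub).length_le
    simp only [List.length_range] at this
    omega
  have hsb : ∀ x ∈ s, t.length ≤ x := by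
    intro x hx
    by_contra hlt'
    push Not at hlt'
    have h1 : t.Perm (List.range t.length) := perm_range_iff.2 ⟨hdt, rfl, htb⟩
    exact hdst x hx x (h1.symm.subset (List.mem_range.2 hlt')) rfl
  rw [List.length_append] at hlen
  have hmap : (s.map (· - t.length)).map (· + t.length) = s := by
    rw [List.map_map]
    conv_rhs => rw [← List.map_id s]
    apply List.map_congr_left
    intro x hx
    have := hsb x hx
    simp only [Function.comp_apply, id]
    omega
  refine ⟨s.length, t.length, hlen, s.map (· - t.length), ?_, t, ?_, by rw [hmap]⟩
  · rw [mem_avWords]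
    refine ⟨⟨?_, by simp, ?_⟩, ?_⟩
    · refine List.Nodup.of_map (· + t.length) ?_
      rwa [hmap]
    · intro x hx
      obtain ⟨y, hy, rfl⟩ := List.mem_map.1 hx
      have := hsb y hy
      have := hlt y (by simp [hy])
      omega
    · rw [← wordAvoids_map_add (b := t.length), hmap]
      exact hav.sublist (List.sublist_append_left _ _)
  · rw [mem_avWords]
    exact ⟨⟨hdt, rfl, htb⟩,
      hav.sublist ((List.sublist_cons_self _ _).trans (List.sublist_append_right _ _))⟩

theorem append_cons_inj_of_notMem {α : Type*} {n : α} {s s' t t' : List α} (hs : n ∉ s)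
    (hs' : n ∉ s') (h : s ++ n :: t = s' ++ n :: t') : s = s' ∧ t = t' := by
  induction s generalizing s' with
  | nil =>
    cases s' with
    | nil => simpa using h
    | cons y s' =>
      simp only [List.nil_append, List.cons_append, List.cons.injEq] at h
      simp [h.1] at hs'
  | cons x s ih =>
    cases s' with
    | nil =>
      simp only [List.nil_append, List.cons_append, List.cons.injEq] at h
      simp [h.1] at hs
    | cons y s' =>
      simp only [List.cons_append, List.cons.injEq] at h
      simp only [List.mem_cons, not_or] at hs hs'
      obtain ⟨h1, h2⟩ := ih hs.2 hs'.2 h.2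
      exact ⟨by rw [h.1, h1], h2⟩

/-- Splitting a `132`-avoiding word at its maximum. -/
theorem sum_avWords_succ {R : Type*} [AddCommMonoid R] (n : ℕ) (f : List ℕ → R) :
    ∑ l ∈ avWords (n + 1), f l = ∑ p ∈ Finset.HasAntidiagonal.antidiagonal n,
      ∑ s ∈ avWords p.1, ∑ t ∈ avWords p.2, f (s.map (· + p.2) ++ n :: t) := by
  simp_rw [← Finset.sum_product']
  rw [Finset.sum_sigma']
  symm
  refine Finset.sum_nbij (fun x => x.2.1.map (· + x.1.2) ++ n :: x.2.2) ?_ ?_ ?_ (fun _ _ => rfl)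
  · rintro ⟨⟨a, b⟩, s, t⟩ hx
    simp only [Finset.mem_sigma, Finset.HasAntidiagonal.mem_antidiagonal, Finset.mem_product] at hx
    obtain ⟨rfl, hs, ht⟩ := hx
    exact append_cons_mem_avWords hs ht
  · rintro ⟨⟨a, b⟩, s, t⟩ hx ⟨⟨a', b'⟩, s', t'⟩ hx' h
    simp only [Finset.mem_coe, Finset.mem_sigma, Finset.HasAntidiagonal.mem_antidiagonal,
      Finset.mem_product] at hx hx'
    obtain ⟨hn, hs, ht⟩ := hx
    obtain ⟨hn', hs', ht'⟩ := hx'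
    rw [mem_avWords] at hs ht hs' ht'
    have h1 : n ∉ s.map (· + b) := by
      intro hm
      obtain ⟨y, hy, he⟩ := List.mem_map.1 hm
      have := hs.1.2.2 y hy
      omega
    have h2 : n ∉ s'.map (· + b') := by
      intro hm
      obtain ⟨y, hy, he⟩ := List.mem_map.1 hm
      have := hs'.1.2.2 y hy
      omega
    obtain ⟨h3, rfl⟩ := append_cons_inj_of_notMem h1 h2 h
    obtain rfl : b = b' := by rw [← ht.1.2.1, ← ht'.1.2.1]
    obtain rfl : a = a' := by omega
    obtain rfl := List.map_injective_iff.2 (add_left_injective b) h3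
    rfl
  · intro l hl
    obtain ⟨a, b, hab, s, hs, t, ht, rfl⟩ := exists_of_mem_avWords hl
    exact ⟨⟨(a, b), s, t⟩, by simp [hab, hs, ht], rfl⟩

/-! ### Generating functions of the diagonal counts -/

section

open PowerSeries Finset.HasAntidiagonal

/-- The coefficient of `x ^ n` in `x ^ r * c ^ (r + 1)`, where `c` is the Catalan series. -/
noncomputable def catalanPowCoeff (r n : ℕ) : ℕ :=
  coeff n ((X : ℕ⟦X⟧) ^ r * catalanSeries ^ (r + 1))

theorem catalanPowCoeff_zero_left (n : ℕ) : catalanPowCoeff 0 n = catalan n := by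
  simp [catalanPowCoeff]

theorem catalanPowCoeff_succ_zero (r : ℕ) : catalanPowCoeff (r + 1) 0 = 0 := by
  simp [catalanPowCoeff]

theorem catalanPowCoeff_succ_succ (r n : ℕ) : catalanPowCoeff (r + 1) (n + 1) =
    ∑ m ∈ Finset.range (n + 1), catalan (n - m) * catalanPowCoeff r m := by
  have h : (X : ℕ⟦X⟧) ^ (r + 1) * catalanSeries ^ (r + 1 + 1) =
      X * ((X ^ r * catalanSeries ^ (r + 1)) * catalanSeries) := by ring
  rw [catalanPowCoeff, h, coeff_succ_X_mul, coeff_mul,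
    Finset.Nat.sum_antidiagonal_eq_sum_range_succ_mk]
  refine Finset.sum_congr rfl fun m _ => ?_
  rw [catalanSeries_coeff, mul_comm, catalanPowCoeff]

/-- The series `∑ r, catalanPowCoeff r n * X ^ r`. -/
noncomputable def catalanPowSeries (n : ℕ) : ℕ⟦X⟧ := PowerSeries.mk fun r => catalanPowCoeff r n

/-- The generating function of the `132`-avoiding words of length `n` with marked positions on
the diagonal `i - l i = d`. -/
noncomputable def shiftedCatalanPowSeries (n : ℕ) (d : ℤ) : ℕ⟦X⟧ :=
  C (catalan n) + X * ∑ m ∈ Finset.range n,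
    if m + 1 + d.natAbs ≤ n then C (catalan (n - 1 - m)) * catalanPowSeries m else 0

/-- Peeling one factor `x c` off `x^(r+1) c^(r+2)` expresses each `catalanPowSeries` through the
earlier ones; at `d = 0` the cutoff on `m` is vacuous. -/
theorem shiftedCatalanPowSeries_zero (n : ℕ) :
    shiftedCatalanPowSeries n 0 = catalanPowSeries n := by
  ext r
  rw [shiftedCatalanPowSeries, catalanPowSeries, coeff_mk, map_add]
  cases r with
  | zero => simp [catalanPowCoeff_zero_left]
  | succ r =>
    rw [coeff_succ_X_mul, coeff_C, if_neg (Nat.succ_ne_zero r), zero_add, map_sum]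
    cases n with
    | zero => simp [catalanPowCoeff_succ_zero]
    | succ n =>
      rw [catalanPowCoeff_succ_succ]
      refine Finset.sum_congr rfl fun m hm => ?_
      rw [Finset.mem_range] at hm
      rw [if_pos (by simp; omega), coeff_C_mul, catalanPowSeries, coeff_mk]
      simp

/-- Lets blocks of different sizes share one summation range. -/
theorem shiftedCatalanPowSeries_eq_of_le {n N : ℕ} (h : n ≤ N) (d : ℤ) :
    shiftedCatalanPowSeries n d = C (catalan n) + X * ∑ m ∈ Finset.range N,
      if m + 1 + d.natAbs ≤ n then C (catalan (n - 1 - m)) * catalanPowSeries m else 0 := by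
  rw [shiftedCatalanPowSeries]
  congr 2
  refine Finset.sum_subset (Finset.range_mono h) fun m _ hm => if_neg ?_
  rw [Finset.mem_range] at hm
  omega

/-- This compares the coefficients of `X * catalanPowSeries m` in the recurrence: the three terms
come from the upper block, the lower block and the maximum. With `n = m + k + 1`, the blocks account
for `-k ≤ d ≤ k + 1` and the maximum adds `d = -(k + 1)`, completing the symmetric range `|d| ≤ k +
1`. -/
theorem catalan_diagonal_convolution {n m : ℕ} (hm : m ≤ n) (d : ℤ) :
    (∑ p ∈ antidiagonal n,
      ((if m + 1 + (d + p.2).natAbs ≤ p.1 then catalan (p.1 - 1 - m) * catalan p.2 else 0) +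
      (if m + 1 + (d - p.1 - 1).natAbs ≤ p.2 then catalan p.1 * catalan (p.2 - 1 - m) else 0) +
      (if d = -(p.2 : ℤ) ∧ p.1 = m then catalan p.2 else 0))) =
    if m + 1 + d.natAbs ≤ n + 1 then catalan (n - m) else 0 := by
  have h3 : (∑ p ∈ antidiagonal n, if d = -(p.2 : ℤ) ∧ p.1 = m then catalan p.2 else 0) =
      if d = -((n - m : ℕ) : ℤ) then catalan (n - m) else 0 := by
    rw [Finset.sum_eq_single_of_mem (m, n - m) (by simp; omega)]
    · simp
    · rintro ⟨a, b⟩ hp hne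
      rw [mem_antidiagonal] at hp
      refine if_neg ?_
      rintro ⟨-, rfl⟩
      exact hne (by simp at hp ⊢; omega)
  rw [Finset.sum_add_distrib, Finset.sum_add_distrib, h3]
  obtain ⟨k, rfl⟩ := Nat.exists_eq_add_of_le hm
  rw [Nat.add_sub_cancel_left]
  cases k with
  | zero =>
    rw [Finset.sum_eq_zero, Finset.sum_eq_zero]
    · simp
    · rintro ⟨a, b⟩ hp
      rw [mem_antidiagonal] at hp
      exact if_neg (by simp at hp ⊢; omega)
    · rintro ⟨a, b⟩ hp
      rw [mem_antidiagonal] at hp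
      exact if_neg (by simp at hp ⊢; omega)
  | succ k =>
    have h1 : (∑ p ∈ antidiagonal (m + (k + 1)),
        if m + 1 + (d + p.2).natAbs ≤ p.1 then catalan (p.1 - 1 - m) * catalan p.2 else 0) =
        ∑ p ∈ antidiagonal k,
          if (d + p.2).natAbs ≤ p.1 then catalan p.1 * catalan p.2 else 0 := by
      rw [Finset.Nat.sum_antidiagonal_eq_sum_range_succ_mk,
        Finset.Nat.sum_antidiagonal_eq_sum_range_succ_mk,
        show (m + (k + 1)).succ = (m + 1) + (k + 1) by omega, Finset.sum_range_add,
        Finset.sum_eq_zero, zero_add]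
      · refine Finset.sum_congr rfl fun i hi => ?_
        simp only
        rw [show m + (k + 1) - (m + 1 + i) = k - i by omega,
          show m + 1 + i - 1 - m = i by omega]
        exact if_congr (by omega) rfl rfl
      · intro i hi
        rw [Finset.mem_range] at hi
        exact if_neg (by simp; omega)
    have h2 : (∑ p ∈ antidiagonal (m + (k + 1)),
        if m + 1 + (d - p.1 - 1).natAbs ≤ p.2 then catalan p.1 * catalan (p.2 - 1 - m) else 0) =
        ∑ p ∈ antidiagonal k,
          if (d - p.1 - 1).natAbs ≤ p.2 then catalan p.1 * catalan p.2 else 0 := by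
      rw [Finset.Nat.sum_antidiagonal_eq_sum_range_succ_mk,
        Finset.Nat.sum_antidiagonal_eq_sum_range_succ_mk,
        show (m + (k + 1)).succ = (k + 1) + (m + 1) by omega, Finset.sum_range_add]
      conv_rhs => rw [← add_zero (Finset.sum _ _)]
      congr 1
      · refine Finset.sum_congr rfl fun i hi => ?_
        rw [Finset.mem_range] at hi
        simp only
        rw [show m + (k + 1) - i - 1 - m = k - i by omega]
        exact if_congr (by omega) rfl rfl
      · refine Finset.sum_eq_zero fun i hi => if_neg ?_
        simp only
        omega
    rw [h1, h2, ← Finset.sum_add_distrib]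
    have h4 : (∑ p ∈ antidiagonal k,
        ((if (d + p.2).natAbs ≤ p.1 then catalan p.1 * catalan p.2 else 0) +
        if (d - p.1 - 1).natAbs ≤ p.2 then catalan p.1 * catalan p.2 else 0)) =
        if -(k : ℤ) ≤ d ∧ d ≤ k + 1 then catalan (k + 1) else 0 := by
      split_ifs with hd
      · rw [catalan_succ']
        refine Finset.sum_congr rfl fun p hp => ?_
        rw [mem_antidiagonal] at hp
        -- For `d` in range, each split satisfies exactly one of the two conditions, so the sum is
        -- the full Catalan convolution.
        by_cases hle : d ≤ p.1 - p.2
        · rw [if_pos (by omega), if_neg (by omega), add_zero]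
        · rw [if_neg (by omega), if_pos (by omega), zero_add]
      · refine Finset.sum_eq_zero fun p hp => ?_
        rw [mem_antidiagonal] at hp
        rw [if_neg (by omega), if_neg (by omega), add_zero]
    rw [h4]
    by_cases hd : d = -((k + 1 : ℕ) : ℤ)
    · rw [if_neg (by omega), if_pos hd, if_pos (by omega), zero_add]
    · rw [if_neg hd, add_zero]
      exact if_congr (by omega) rfl rfl

/-- The closed form obeys the recurrence forced by splitting at the maximum, which sits at position
`p.1` with value `n`, hence on the diagonal `-p.2`. -/
theorem shiftedCatalanPowSeries_succ (n : ℕ) (d : ℤ) :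
    shiftedCatalanPowSeries (n + 1) d = ∑ p ∈ antidiagonal n,
      shiftedCatalanPowSeries p.1 (d + p.2) * shiftedCatalanPowSeries p.2 (d - p.1 - 1) *
        (1 + X) ^ (if d = -(p.2 : ℤ) then 1 else 0) := by
  have key : ∀ p ∈ antidiagonal n,
      shiftedCatalanPowSeries p.1 (d + p.2) * shiftedCatalanPowSeries p.2 (d - p.1 - 1) *
        (1 + X) ^ (if d = -(p.2 : ℤ) then 1 else 0) =
      C (catalan p.1 * catalan p.2) + X * ∑ m ∈ Finset.range (n + 1), C (
        (if m + 1 + (d + p.2).natAbs ≤ p.1 then catalan (p.1 - 1 - m) * catalan p.2 else 0) +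
        (if m + 1 + (d - p.1 - 1).natAbs ≤ p.2 then catalan p.1 * catalan (p.2 - 1 - m) else 0) +
        (if d = -(p.2 : ℤ) ∧ p.1 = m then catalan p.2 else 0)) * catalanPowSeries m := by
    rintro ⟨a, b⟩ hp
    rw [mem_antidiagonal] at hp
    simp only at hp ⊢
    simp only [map_add, add_mul, Finset.sum_add_distrib]
    have e3 : (∑ m ∈ Finset.range (n + 1),
        C (if d = -(b : ℤ) ∧ a = m then catalan b else 0) * catalanPowSeries m) =
        if d = -(b : ℤ) then C (catalan b) * catalanPowSeries a else 0 := by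
      rw [Finset.sum_eq_single_of_mem a (by simp; omega)]
      · simp only [and_true]
        split_ifs <;> simp
      · intro m _ hm
        rw [if_neg (fun h => hm h.2.symm)]
        simp
    have e1 : (∑ m ∈ Finset.range (n + 1), C (if m + 1 + (d + b).natAbs ≤ a then
        catalan (a - 1 - m) * catalan b else 0) * catalanPowSeries m) =
        C (catalan b) * ∑ m ∈ Finset.range (n + 1),
          if m + 1 + (d + b).natAbs ≤ a then C (catalan (a - 1 - m)) * catalanPowSeries m
          else 0 := by
      rw [Finset.mul_sum]
      refine Finset.sum_congr rfl fun m _ => ?_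
      split_ifs
      · rw [map_mul]; ring
      · simp
    have e2 : (∑ m ∈ Finset.range (n + 1), C (if m + 1 + (d - a - 1).natAbs ≤ b then
        catalan a * catalan (b - 1 - m) else 0) * catalanPowSeries m) =
        C (catalan a) * ∑ m ∈ Finset.range (n + 1),
          if m + 1 + (d - a - 1).natAbs ≤ b then C (catalan (b - 1 - m)) * catalanPowSeries m
          else 0 := by
      rw [Finset.mul_sum]
      refine Finset.sum_congr rfl fun m _ => ?_
      split_ifs
      · rw [map_mul]; ring
      · simp
    rw [e1, e2, e3]
    by_cases hd : d = -(b : ℤ)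
    -- A diagonal through the maximum is the main diagonal of the upper block and misses the lower
    -- one.
    · have hV : shiftedCatalanPowSeries b (d - a - 1) = C (catalan b) := by
        rw [shiftedCatalanPowSeries, Finset.sum_eq_zero, mul_zero, add_zero]
        intro m _
        exact if_neg (by omega)
      have hV' : (∑ m ∈ Finset.range (n + 1), if m + 1 + (d - a - 1).natAbs ≤ b then
          C (catalan (b - 1 - m)) * catalanPowSeries m else 0) = 0 :=
        Finset.sum_eq_zero fun m _ => if_neg (by omega)
      rw [hV, hV', if_pos hd, if_pos hd, ← shiftedCatalanPowSeries_zero a,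
        show (0 : ℤ) = d + b by omega,
        shiftedCatalanPowSeries_eq_of_le (show a ≤ n + 1 by omega), map_mul]
      ring
    · rw [if_neg hd, if_neg hd, pow_zero, mul_one,
        shiftedCatalanPowSeries_eq_of_le (show a ≤ n + 1 by omega),
        shiftedCatalanPowSeries_eq_of_le (show b ≤ n + 1 by omega), map_mul]
      set U := ∑ m ∈ Finset.range (n + 1), if m + 1 + (d + b).natAbs ≤ a then
          C (catalan (a - 1 - m)) * catalanPowSeries m else 0 with hU
      set V := ∑ m ∈ Finset.range (n + 1), if m + 1 + (d - a - 1).natAbs ≤ b then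
          C (catalan (b - 1 - m)) * catalanPowSeries m else 0 with hV
      -- No diagonal meets both blocks, so the quadratic term vanishes.
      have hUV : U * V = 0 := by
        by_cases h : d + b < a
        · rw [hV, Finset.sum_eq_zero, mul_zero]
          exact fun m _ => if_neg (by omega)
        · rw [hU, Finset.sum_eq_zero, zero_mul]
          exact fun m _ => if_neg (by omega)
      calc (C (catalan a) + X * U) * (C (catalan b) + X * V)
          = C (catalan a) * C (catalan b) + X * (C (catalan b) * U + C (catalan a) * V) +
            X ^ 2 * (U * V) := by ring
        _ = _ := by rw [hUV]; ring
  rw [Finset.sum_congr rfl key, Finset.sum_add_distrib, ← Finset.mul_sum, Finset.sum_comm,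
    shiftedCatalanPowSeries, catalan_succ', map_sum]
  congr 2
  refine Finset.sum_congr rfl fun m hm => ?_
  rw [Finset.mem_range] at hm
  rw [← Finset.sum_mul, ← map_sum, catalan_diagonal_convolution (by omega)]
  simp only [Nat.add_sub_cancel]
  split_ifs <;> simp

theorem sum_avWords_one_add_X_pow_diagCount (n : ℕ) (d : ℤ) :
    ∑ l ∈ avWords n, (1 + X : ℕ⟦X⟧) ^ diagCount d l = shiftedCatalanPowSeries n d := by
  induction n using Nat.strong_induction_on generalizing d with
  | _ n ih =>
    cases n with
    | zero =>
      have : avWords 0 = {[]} := by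
        ext l
        rw [mem_avWords]
        constructor
        · rintro ⟨⟨-, h, -⟩, -⟩
          simpa using h
        · intro h
          rw [Finset.mem_singleton] at h
          subst h
          simp [WordAvoids]
      simp [this, diagCount, shiftedCatalanPowSeries]
    | succ n =>
      rw [sum_avWords_succ, shiftedCatalanPowSeries_succ]
      refine Finset.sum_congr rfl fun p hp => ?_
      rw [mem_antidiagonal] at hp
      rw [← ih p.1 (by omega), ← ih p.2 (by omega), Finset.sum_mul_sum, Finset.sum_mul]
      refine Finset.sum_congr rfl fun s hs => ?_
      rw [Finset.sum_mul]
      refine Finset.sum_congr rfl fun t ht => ?_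
      have hlen : s.length = p.1 := (mem_avWords.1 hs).1.2.1
      rw [diagCount_append, diagCount_map_add, diagCount, List.length_map, hlen, pow_add, pow_add]
      rw [if_congr (show -(n : ℤ) = d - p.1 ↔ d = -(p.2 : ℤ) by omega) rfl rfl]
      ring

/-- The binomial moments of the number of fixed points over the `132`-avoiding words. -/
theorem sum_avWords_choose_diagCount (n r : ℕ) :
    ∑ l ∈ avWords n, (diagCount 0 l).choose r = catalanPowCoeff r n := by
  have h := congrArg (coeff r) (sum_avWords_one_add_X_pow_diagCount n 0)
  rw [shiftedCatalanPowSeries_zero, catalanPowSeries, coeff_mk, map_sum] at h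
  rw [← h]
  refine Finset.sum_congr rfl fun l _ => ?_
  have h2 : (1 + X : ℕ⟦X⟧) ^ diagCount 0 l =
      (((1 + Polynomial.X : Polynomial ℕ) ^ diagCount 0 l : Polynomial ℕ) : ℕ⟦X⟧) := by
    simp
  rw [h2, Polynomial.coeff_coe, Polynomial.coeff_one_add_X_pow]
  simp

end

/-! ### From words to permutations, and the symmetry between 132 and 213 -/

theorem contains_iff_exists_triple {n : ℕ} (τ : Equiv.Perm (Fin n)) (σ : Equiv.Perm (Fin 3)) :
    Contains τ σ ↔ ∃ i j k : Fin n, i < j ∧ j < k ∧ (τ i < τ j ↔ σ 0 < σ 1) ∧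
      (τ i < τ k ↔ σ 0 < σ 2) ∧ (τ j < τ k ↔ σ 1 < σ 2) := by
  constructor
  · rintro ⟨f, hf, h⟩
    exact ⟨f 0, f 1, f 2, hf (by decide), hf (by decide), h 0 1 (by decide), h 0 2 (by decide),
      h 1 2 (by decide)⟩
  · rintro ⟨i, j, k, hij, hjk, h1, h2, h3⟩
    refine ⟨![i, j, k], ?_, ?_⟩
    · rw [Fin.strictMono_iff_lt_succ]
      intro a
      fin_cases a
      · exact hij
      · exact hjk
    · intro s t hst
      fin_cases s <;> fin_cases t <;> first | exact absurd hst (by decide) | assumption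

theorem contains_p132_iff {n : ℕ} (τ : Equiv.Perm (Fin n)) :
    Contains τ p132 ↔ ∃ i j k : Fin n, i < j ∧ j < k ∧ τ i < τ k ∧ τ k < τ j := by
  rw [contains_iff_exists_triple]
  refine exists_congr fun i => exists_congr fun j => exists_congr fun k => and_congr_right
    fun hij => and_congr_right fun hjk => ?_
  have hne : τ j ≠ τ k := fun h => hjk.ne (τ.injective h)
  rw [show (p132 0 < p132 1) = True by simp [coe_p132],
    show (p132 0 < p132 2) = True by simp [coe_p132],
    show (p132 1 < p132 2) = False by simp [coe_p132]]
  grind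

theorem contains_p213_iff {n : ℕ} (τ : Equiv.Perm (Fin n)) :
    Contains τ p213 ↔ ∃ i j k : Fin n, i < j ∧ j < k ∧ τ j < τ i ∧ τ i < τ k := by
  rw [contains_iff_exists_triple]
  refine exists_congr fun i => exists_congr fun j => exists_congr fun k => and_congr_right
    fun hij => and_congr_right fun hjk => ?_
  have hne : τ i ≠ τ j := fun h => hij.ne (τ.injective h)
  rw [show (p213 0 < p213 1) = False by simp [coe_p213],
    show (p213 0 < p213 2) = True by simp [coe_p213],
    show (p213 1 < p213 2) = True by simp [coe_p213]]
  grind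

/-- The one-line notation of a permutation. -/
def toWord {n : ℕ} (τ : Equiv.Perm (Fin n)) : List ℕ := (List.finRange n).map fun i => (τ i : ℕ)

theorem toWord_injective {n : ℕ} : Function.Injective (toWord (n := n)) := by
  intro τ τ' h
  ext i
  have := List.map_inj_left.1 h i (List.mem_finRange i)
  exact this

open List in
theorem triple_sublist_finRange_iff {n : ℕ} {i j k : Fin n} :
    [i, j, k] <+ List.finRange n ↔ i < j ∧ j < k := by
  constructor
  · intro h
    have := (List.pairwise_lt_finRange n).sublist h
    simp only [List.pairwise_cons, List.mem_cons, List.not_mem_nil, or_false, forall_eq_or_imp,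
      forall_eq] at this
    exact ⟨this.1.1, this.2.1⟩
  · rintro ⟨hij, hjk⟩
    have hik := hij.trans hjk
    have hp : [i, j, k].Pairwise (· ≤ ·) := by simp [hij.le, hjk.le, hik.le]
    refine List.sublist_of_subperm_of_pairwise (r := (· ≤ ·)) ?_ hp (List.pairwise_le_finRange n)
    refine List.subperm_of_subset ?_ fun x _ => List.mem_finRange x
    simp [hij.ne, hjk.ne, hik.ne]

theorem wordAvoids_toWord_iff {n : ℕ} (τ : Equiv.Perm (Fin n)) :
    WordAvoids (toWord τ) ↔ τ ∈ Av n p132 := by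
  rw [Av, Set.mem_ofPred_eq, contains_p132_iff]
  constructor
  · rintro h ⟨i, j, k, hij, hjk, h1, h2⟩
    exact h (τ i) (τ j) (τ k)
      ((triple_sublist_finRange_iff.2 ⟨hij, hjk⟩).map fun i => (τ i : ℕ)) ⟨h1, h2⟩
  · intro h a b c hs habc
    obtain ⟨l, hl, he⟩ := List.sublist_map_iff.1 hs
    match l, he with
    | [i, j, k], he =>
      simp only [List.map_cons, List.map_nil, List.cons.injEq, and_true] at he
      obtain ⟨rfl, rfl, rfl⟩ := he
      obtain ⟨hij, hjk⟩ := triple_sublist_finRange_iff.1 hl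
      exact h ⟨i, j, k, hij, hjk, habc.1, habc.2⟩

theorem diagCount_map_finRange {n : ℕ} (d : ℤ) (f : Fin n → ℕ) :
    diagCount d ((List.finRange n).map f) = ∑ i : Fin n, if (i : ℤ) - f i = d then 1 else 0 := by
  induction n generalizing d with
  | zero => simp [diagCount]
  | succ n ih =>
    rw [List.finRange_succ, List.map_cons, List.map_map, diagCount, ih, Fin.sum_univ_succ]
    congr 1
    · simp
    · refine Finset.sum_congr rfl fun i _ => if_congr ?_ rfl rfl
      simp only [Function.comp_apply, Fin.val_succ, Nat.cast_add, Nat.cast_one]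
      omega

theorem diagCount_toWord {n : ℕ} (τ : Equiv.Perm (Fin n)) :
    diagCount 0 (toWord τ) = numFixedPoints τ := by
  rw [toWord, diagCount_map_finRange, numFixedPoints]
  refine Finset.sum_congr rfl fun i _ => if_congr ?_ rfl rfl
  rw [Fin.ext_iff]
  omega

theorem toWord_mem_avWords {n : ℕ} {τ : Equiv.Perm (Fin n)} (h : τ ∈ Av n p132) :
    toWord τ ∈ avWords n := by
  rw [mem_avWords, wordAvoids_toWord_iff]
  refine ⟨⟨?_, by simp [toWord], ?_⟩, h⟩
  · exact (List.nodup_finRange n).map (Fin.val_injective.comp τ.injective)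
  · intro x hx
    obtain ⟨i, -, rfl⟩ := List.mem_map.1 hx
    exact (τ i).2

theorem exists_toWord_eq {n : ℕ} {l : List ℕ} (h : l ∈ avWords n) :
    ∃ τ ∈ Av n p132, toWord τ = l := by
  rw [mem_avWords] at h
  obtain ⟨⟨hd, rfl, hlt⟩, hav⟩ := h
  let f : Fin l.length → Fin l.length := fun i => ⟨l.get i, hlt _ (l.get_mem i)⟩
  have hf : Function.Injective f := fun i j hij =>
    List.nodup_iff_injective_get.1 hd (congrArg Fin.val hij)
  let τ : Equiv.Perm (Fin l.length) := Equiv.ofBijective f (Finite.injective_iff_bijective.1 hf)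
  have hτ : toWord τ = l := List.map_get_finRange l
  exact ⟨τ, (wordAvoids_toWord_iff τ).1 (by rwa [hτ]), hτ⟩

/-- `Av_n(σ)` as a finite set. -/
noncomputable def avFinset (n : ℕ) {k : ℕ} (σ : Equiv.Perm (Fin k)) :
    Finset (Equiv.Perm (Fin n)) :=
  (Set.toFinite (Av n σ)).toFinset

theorem mem_avFinset {n k : ℕ} {σ : Equiv.Perm (Fin k)} {τ : Equiv.Perm (Fin n)} :
    τ ∈ avFinset n σ ↔ τ ∈ Av n σ := by
  simp [avFinset]

theorem sum_avFinset_p132 (n r : ℕ) :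
    ∑ τ ∈ avFinset n p132, (numFixedPoints τ).choose r = catalanPowCoeff r n := by
  rw [← sum_avWords_choose_diagCount]
  refine Finset.sum_nbij toWord (fun τ hτ => toWord_mem_avWords (mem_avFinset.1 hτ))
    toWord_injective.injOn (fun l hl => ?_) (fun τ _ => by rw [diagCount_toWord])
  obtain ⟨τ, hτ, rfl⟩ := exists_toWord_eq hl
  exact ⟨τ, mem_avFinset.2 hτ, rfl⟩

/-- The reverse-complement of a permutation. -/
def revCompl {n : ℕ} (τ : Equiv.Perm (Fin n)) : Equiv.Perm (Fin n) :=
  Fin.revPerm.trans (τ.trans Fin.revPerm)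

theorem revCompl_apply {n : ℕ} (τ : Equiv.Perm (Fin n)) (i : Fin n) :
    revCompl τ i = (τ i.rev).rev := rfl

theorem revCompl_revCompl {n : ℕ} (τ : Equiv.Perm (Fin n)) : revCompl (revCompl τ) = τ := by
  ext i
  simp [revCompl_apply]

theorem numFixedPoints_revCompl {n : ℕ} (τ : Equiv.Perm (Fin n)) :
    numFixedPoints (revCompl τ) = numFixedPoints τ := by
  rw [numFixedPoints, numFixedPoints, ← Equiv.sum_comp Fin.revPerm]
  refine Finset.sum_congr rfl fun i _ => if_congr ?_ rfl rfl
  simp [revCompl_apply]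

theorem revCompl_mem_Av_p132_iff {n : ℕ} (τ : Equiv.Perm (Fin n)) :
    revCompl τ ∈ Av n p132 ↔ τ ∈ Av n p213 := by
  rw [Av, Av, Set.mem_ofPred_eq, Set.mem_ofPred_eq, contains_p132_iff, contains_p213_iff]
  refine not_congr ⟨?_, ?_⟩
  · rintro ⟨i, j, k, h1, h2, h3, h4⟩
    exact ⟨k.rev, j.rev, i.rev, Fin.rev_lt_rev.2 h2, Fin.rev_lt_rev.2 h1, Fin.rev_lt_rev.1 h4,
      Fin.rev_lt_rev.1 h3⟩
  · rintro ⟨i, j, k, h1, h2, h3, h4⟩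
    refine ⟨k.rev, j.rev, i.rev, Fin.rev_lt_rev.2 h2, Fin.rev_lt_rev.2 h1, ?_, ?_⟩ <;>
      simpa [revCompl_apply]

theorem sum_avFinset_p213 (n r : ℕ) :
    ∑ τ ∈ avFinset n p213, (numFixedPoints τ).choose r = catalanPowCoeff r n := by
  rw [← sum_avFinset_p132]
  refine Finset.sum_nbij' revCompl revCompl ?_ ?_ (fun τ _ => revCompl_revCompl τ)
    (fun τ _ => revCompl_revCompl τ) (fun τ _ => by rw [numFixedPoints_revCompl])
  · intro τ hτ
    rwa [mem_avFinset, revCompl_mem_Av_p132_iff, ← mem_avFinset]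
  · intro τ hτ
    rwa [mem_avFinset, ← revCompl_mem_Av_p132_iff, revCompl_revCompl, ← mem_avFinset]

/-! ### Closed form of the binomial moments -/

open PowerSeries in
theorem catalanPowCoeff_recurrence (r n : ℕ) :
    catalanPowCoeff (r + 2) (n + 1) + catalanPowCoeff r n = catalanPowCoeff (r + 1) (n + 1) := by
  have h : (X : ℕ⟦X⟧) ^ (r + 1) * catalanSeries ^ (r + 1 + 1) =
      X ^ (r + 2) * catalanSeries ^ (r + 2 + 1) +
        X * (X ^ r * catalanSeries ^ (r + 1)) := by
    calc (X : ℕ⟦X⟧) ^ (r + 1) * catalanSeries ^ (r + 1 + 1)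
        = X ^ (r + 1) * catalanSeries ^ (r + 1) * catalanSeries := by ring
      -- The functional equation `c = 1 + x c^2`, applied to one factor.
      _ = X ^ (r + 1) * catalanSeries ^ (r + 1) * (catalanSeries ^ 2 * X + 1) := by
          rw [catalanSeries_sq_mul_X_add_one]
      _ = _ := by ring
  rw [catalanPowCoeff, catalanPowCoeff, catalanPowCoeff, h, map_add, coeff_succ_X_mul]

theorem catalanPowCoeff_one_succ (n : ℕ) :
    catalanPowCoeff 1 (n + 1) = catalan (n + 1) := by
  rw [catalanPowCoeff_succ_succ, catalan_succ', Finset.Nat.sum_antidiagonal_eq_sum_range_succ_mk]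
  refine Finset.sum_congr rfl fun m _ => ?_
  rw [catalanPowCoeff_zero_left, mul_comm]

open PowerSeries in
theorem catalanPowCoeff_eq_zero_of_lt {r n : ℕ} (h : n < r) : catalanPowCoeff r n = 0 := by
  rw [catalanPowCoeff, coeff_X_pow_mul', if_neg (by omega)]

theorem catalan_succ_recurrence (n : ℕ) :
    ((n : ℝ) + 2) * catalan (n + 1) = 2 * (2 * n + 1) * catalan n := by
  have h1 := succ_mul_catalan_eq_centralBinom n
  have h2 := succ_mul_catalan_eq_centralBinom (n + 1)
  have h3 := Nat.succ_mul_centralBinom_succ n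
  rw [← h1, ← h2] at h3
  have h4 : ((n : ℝ) + 1) * (((n : ℝ) + 2) * catalan (n + 1)) =
      ((n : ℝ) + 1) * (2 * (2 * n + 1) * catalan n) := by
    have : (((n + 1) * ((n + 1 + 1) * catalan (n + 1)) : ℕ) : ℝ) =
      ((2 * (2 * n + 1) * ((n + 1) * catalan n) : ℕ) : ℝ) := by rw [h3]
    push_cast at this
    linear_combination this
  exact mul_left_cancel₀ (by positivity) h4

/-- Denominators are cleared because `2 * n - j` can vanish when `r > 2 * n`. The two-step
recurrence in `r` drives the induction, with the ratio of consecutive Catalan numbers matching the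
terms at `n` and `n + 1`. -/
theorem catalanPowCoeff_mul_prod (r n : ℕ) :
    (catalanPowCoeff r n : ℝ) * ∏ j ∈ Finset.range r, (2 * (n : ℝ) - j) =
      (r + 1) * (∏ j ∈ Finset.range r, ((n : ℝ) - j)) * catalan n := by
  induction r using Nat.strong_induction_on generalizing n with
  | _ r ih =>
    match r, n with
    | 0, n => simp [catalanPowCoeff_zero_left]
    | r + 1, 0 =>
      rw [catalanPowCoeff_succ_zero, Finset.prod_range_succ' (fun j => (((0 : ℕ) : ℝ) - j))]
      simp
    | 1, n + 1 =>
      rw [catalanPowCoeff_one_succ]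
      simp
      ring
    | r + 2, n + 1 =>
      have h1 := ih (r + 1) (by omega) (n + 1)
      have h2 := ih r (by omega) n
      have h3 : (catalanPowCoeff (r + 2) (n + 1) : ℝ) + catalanPowCoeff r n =
          catalanPowCoeff (r + 1) (n + 1) := by exact_mod_cast catalanPowCoeff_recurrence r n
      have h4 := catalan_succ_recurrence n
      have h5 : ∏ j ∈ Finset.range (r + 1), (((n + 1 : ℕ) : ℝ) - j) =
          (∏ j ∈ Finset.range r, ((n : ℝ) - j)) * (n + 1) := by
        rw [Finset.prod_range_succ']
        push_cast
        congr 1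
        · refine Finset.prod_congr rfl fun j _ => by ring
        · ring
      have h6 : ∏ j ∈ Finset.range (r + 2), (2 * ((n + 1 : ℕ) : ℝ) - j) =
          (∏ j ∈ Finset.range r, (2 * (n : ℝ) - j)) * (2 * n + 1) * (2 * n + 2) := by
        rw [Finset.prod_range_succ', Finset.prod_range_succ']
        push_cast
        congr 1
        · congr 1
          · refine Finset.prod_congr rfl fun j _ => by ring
          · ring
        · ring
      have h7 := Finset.prod_range_succ (fun j : ℕ => 2 * ((n + 1 : ℕ) : ℝ) - j) (r + 1)
      have h8 := Finset.prod_range_succ (fun j : ℕ => ((n + 1 : ℕ) : ℝ) - j) (r + 1)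
      rw [h8, h5]
      rw [h5] at h1
      have e1 : (catalanPowCoeff (r + 1) (n + 1) : ℝ) *
          ∏ j ∈ Finset.range (r + 2), (2 * ((n + 1 : ℕ) : ℝ) - j) =
          (r + 2) * ((∏ j ∈ Finset.range r, ((n : ℝ) - j)) * (n + 1)) * catalan (n + 1) *
            (2 * n + 1 - r) := by
        rw [h7]
        push_cast at h1 ⊢
        linear_combination (2 * (n : ℝ) + 1 - r) * h1
      have e2 : (catalanPowCoeff r n : ℝ) *
          ∏ j ∈ Finset.range (r + 2), (2 * ((n + 1 : ℕ) : ℝ) - j) =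
          (r + 1) * ((∏ j ∈ Finset.range r, ((n : ℝ) - j)) * (n + 1)) *
            ((n + 2) * catalan (n + 1)) := by
        rw [h6, h4]
        linear_combination (2 * (n : ℝ) + 1) * (2 * n + 2) * h2
      rw [eq_sub_of_add_eq h3, sub_mul, e1, e2]
      push_cast
      ring

theorem catalan_pos (n : ℕ) : 0 < catalan n := by
  have h := succ_mul_catalan_eq_centralBinom n
  have := Nat.centralBinom_pos n
  exact Nat.pos_of_ne_zero fun h0 => by rw [h0] at h; omega

/-- The `r`-th binomial moment of the number of fixed points. -/
theorem catalanPowCoeff_div_catalan (r n : ℕ) :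
    (catalanPowCoeff r n : ℝ) / catalan n =
      (r + 1) * ∏ j ∈ Finset.range r, (((n : ℝ) - j) / (2 * n - j)) := by
  have hc : (catalan n : ℝ) ≠ 0 := by exact_mod_cast (catalan_pos n).ne'
  rcases lt_or_ge n r with h | h
  -- The factor `j = n` is zero; for `n = 0` it is `0 / 0`, which is `0` by convention.
  · rw [catalanPowCoeff_eq_zero_of_lt h, Finset.prod_eq_zero (Finset.mem_range.2 h) (by simp)]
    simp
  · have hne : ∏ j ∈ Finset.range r, (2 * (n : ℝ) - j) ≠ 0 := by
      refine Finset.prod_ne_zero_iff.2 fun j hj => ?_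
      have : (j : ℝ) < n := by exact_mod_cast (Finset.mem_range.1 hj).trans_le h
      have : (0 : ℝ) ≤ j := by positivity
      intro h0
      linarith
    rw [Finset.prod_div_distrib, div_eq_iff hc, mul_div_assoc', div_mul_eq_mul_div, eq_div_iff hne,
      catalanPowCoeff_mul_prod]

/-! ### Limits of the moments and binomial inversion -/

theorem prod_ratio_nonneg_le (r n : ℕ) :
    0 ≤ ∏ j ∈ Finset.range r, (((n : ℝ) - j) / (2 * n - j)) ∧
      ∏ j ∈ Finset.range r, (((n : ℝ) - j) / (2 * n - j)) ≤ (1 / 2) ^ r := by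
  rcases lt_or_ge n r with h | h
  · rw [Finset.prod_eq_zero (Finset.mem_range.2 h) (by simp)]
    exact ⟨le_rfl, by positivity⟩
  · have key : ∀ j ∈ Finset.range r, 0 ≤ ((n : ℝ) - j) / (2 * n - j) ∧
        ((n : ℝ) - j) / (2 * n - j) ≤ 1 / 2 := by
      intro j hj
      have h1 : (j : ℝ) < n := by exact_mod_cast (Finset.mem_range.1 hj).trans_le h
      have h2 : (0 : ℝ) ≤ j := by positivity
      refine ⟨div_nonneg (by linarith) (by linarith), ?_⟩
      rw [div_le_div_iff₀ (by linarith) (by norm_num)]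
      linarith
    refine ⟨Finset.prod_nonneg fun j hj => (key j hj).1, ?_⟩
    calc _ ≤ ∏ j ∈ Finset.range r, (1 / 2 : ℝ) :=
          Finset.prod_le_prod (fun j hj => (key j hj).1) fun j hj => (key j hj).2
      _ = _ := by simp

theorem tendsto_prod_ratio (r : ℕ) :
    Tendsto (fun n : ℕ => ∏ j ∈ Finset.range r, (((n : ℝ) - j) / (2 * n - j))) atTop
      (nhds ((1 / 2) ^ r)) := by
  have h : ∀ j ∈ Finset.range r,
      Tendsto (fun n : ℕ => (((n : ℝ) - j) / (2 * n - j))) atTop (nhds (1 / 2)) := by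
    intro j _
    have h0 : Tendsto (fun n : ℕ => (j : ℝ) / n) atTop (nhds 0) :=
      tendsto_const_div_atTop_nhds_zero_nat _
    have h1 : Tendsto (fun n : ℕ => (1 - (j : ℝ) / n) / (2 - (j : ℝ) / n)) atTop
        (nhds ((1 - 0) / (2 - 0))) :=
      (tendsto_const_nhds.sub h0).div (tendsto_const_nhds.sub h0) (by norm_num)
    rw [sub_zero, sub_zero] at h1
    refine h1.congr' ?_
    filter_upwards [eventually_gt_atTop 0] with n hn
    have hn' : (n : ℝ) ≠ 0 := by positivity
    rw [← mul_div_mul_left _ _ hn', mul_sub, mul_sub, mul_div_cancel₀ _ hn', mul_one, mul_comm 2]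
  simpa using tendsto_finsetProd (Finset.range r) h

/-- Since `binom(k+j,k) binom(m,k+j) = binom(m,k) binom(m-k,j)`, this is an alternating row sum of
Pascal's triangle, nonzero only for `m = k`. -/
theorem sum_range_alternating_choose_mul_choose {k m N : ℕ} (h : m < N) :
    ∑ j ∈ Finset.range N, (-1 : ℝ) ^ j * (k + j).choose k * m.choose (k + j) =
      if m = k then 1 else 0 := by
  rcases lt_or_ge m k with hk | hk
  · rw [if_neg (by omega)]
    refine Finset.sum_eq_zero fun j _ => ?_
    rw [Nat.choose_eq_zero_of_lt (show m < k + j by omega)]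
    simp
  · have h1 : ∀ j, (-1 : ℝ) ^ j * (k + j).choose k * m.choose (k + j) =
        m.choose k * ((-1 : ℝ) ^ j * (m - k).choose j) := by
      intro j
      rcases le_or_gt (k + j) m with hj | hj
      · have := Nat.choose_mul (n := m) (Nat.le_add_right k j)
        rw [Nat.add_sub_cancel_left] at this
        have h2 : (m.choose (k + j) : ℝ) * (k + j).choose k =
            m.choose k * (m - k).choose j := by exact_mod_cast this
        linear_combination (-1 : ℝ) ^ j * h2
      · rw [Nat.choose_eq_zero_of_lt hj, Nat.choose_eq_zero_of_lt (show m - k < j by omega)]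
        simp
    simp_rw [h1]
    rw [← Finset.mul_sum]
    have h3 : ∑ j ∈ Finset.range N, (-1 : ℝ) ^ j * (m - k).choose j =
        ∑ j ∈ Finset.range (m - k + 1), (-1 : ℝ) ^ j * (m - k).choose j := by
      symm
      refine Finset.sum_subset (Finset.range_mono (by omega)) fun j _ hj => ?_
      rw [Finset.mem_range] at hj
      rw [Nat.choose_eq_zero_of_lt (by omega)]
      simp
    have h4 : ∑ j ∈ Finset.range (m - k + 1), (-1 : ℝ) ^ j * (m - k).choose j =
        if m - k = 0 then 1 else 0 := by
      exact_mod_cast Int.alternating_sum_range_choose (n := m - k)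
    rw [h3, h4]
    by_cases hmk : m = k
    · subst hmk
      simp
    · rw [if_neg (by omega), if_neg hmk, mul_zero]

/-- The binomial inversion formula for the distribution of an integer-valued function. -/
theorem card_filter_eq_sum_choose {α : Type*} (S : Finset α) (f : α → ℕ) {N : ℕ}
    (hf : ∀ x ∈ S, f x < N) (k : ℕ) :
    ((S.filter fun x => f x = k).card : ℝ) = ∑ j ∈ Finset.range N,
      (-1 : ℝ) ^ j * (k + j).choose k * ((∑ x ∈ S, (f x).choose (k + j) : ℕ) : ℝ) := by
  push_cast
  simp_rw [Finset.mul_sum]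
  rw [Finset.sum_comm, Finset.card_filter]
  push_cast
  exact Finset.sum_congr rfl fun x hx => (sum_range_alternating_choose_mul_choose (hf x hx)).symm

/-- Absorbs the moment factor `k + j + 1`, turning the inversion series into a negative binomial
series. -/
theorem choose_mul_add_one (k j : ℕ) :
    ((k + j).choose k : ℝ) * (((k + j : ℕ) : ℝ) + 1) = (k + 1) * (j + (k + 1)).choose (k + 1) := by
  have := Nat.add_one_mul_choose_eq (k + j) k
  rw [show k + j + 1 = j + (k + 1) by ring] at this
  have h : (((j + (k + 1) : ℕ)) : ℝ) * (k + j).choose k =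
      (j + (k + 1)).choose (k + 1) * ((k + 1 : ℕ) : ℝ) := by exact_mod_cast this
  push_cast at h ⊢
  linear_combination h

/-- If the binomial moments of `f n` under the uniform measure on `S n` are those of the number of
fixed points, then the mass function converges to that of the sum of two independent
Geometric(2/3) variables. -/
theorem tendsto_card_filter_div {α : ℕ → Type*} (S : ∀ n, Finset (α n)) (f : ∀ n, α n → ℕ)
    (hf : ∀ n, ∀ x ∈ S n, f n x ≤ n)
    (hS : ∀ n r, ∑ x ∈ S n, (f n x).choose r = catalanPowCoeff r n) (k : ℕ) :
    Tendsto (fun n => (((S n).filter fun x => f n x = k).card : ℝ) / (S n).card) atTop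
      (nhds (4 / 9 * ((k : ℝ) + 1) * (1 / 3) ^ k)) := by
  have hcard : ∀ n, (S n).card = catalan n := by
    intro n
    rw [← catalanPowCoeff_zero_left, ← hS]
    simp
  have heq : ∀ n, (((S n).filter fun x => f n x = k).card : ℝ) / (S n).card =
      ∑' j : ℕ, (-1 : ℝ) ^ j * (k + j).choose k *
        ((((k + j : ℕ) : ℝ) + 1) * ∏ i ∈ Finset.range (k + j), (((n : ℝ) - i) / (2 * n - i))) := by
    intro n
    rw [card_filter_eq_sum_choose (S n) (f n) (N := n + 1)
      (fun x hx => Nat.lt_succ_of_le (hf n x hx)) k, hcard, Finset.sum_div,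
      tsum_eq_sum (s := Finset.range (n + 1))]
    · refine Finset.sum_congr rfl fun j _ => ?_
      rw [hS, ← catalanPowCoeff_div_catalan, mul_div_assoc]
    -- Moments of order above `n` vanish, so the finite inversion sum is a full series, ready for
    -- dominated convergence.
    · intro j hj
      rw [Finset.mem_range] at hj
      rw [← catalanPowCoeff_div_catalan, catalanPowCoeff_eq_zero_of_lt (by omega)]
      simp
  have hlim : (4 / 9 * ((k : ℝ) + 1) * (1 / 3) ^ k) =
      ∑' j : ℕ, (-1 : ℝ) ^ j * (k + j).choose k * ((((k + j : ℕ) : ℝ) + 1) * (1 / 2) ^ (k + j)) := by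
    have h1 : ∀ j : ℕ,
        (-1 : ℝ) ^ j * (k + j).choose k * ((((k + j : ℕ) : ℝ) + 1) * (1 / 2) ^ (k + j)) =
        (k + 1) * (1 / 2) ^ k * ((j + (k + 1)).choose (k + 1) * (-1 / 2) ^ j) := by
      intro j
      have e : (-1 / 2 : ℝ) ^ j = (-1) ^ j * (1 / 2) ^ j := by rw [← mul_pow]; norm_num
      rw [e, pow_add]
      linear_combination (-1 : ℝ) ^ j * (1 / 2) ^ k * (1 / 2) ^ j * choose_mul_add_one k j
    simp_rw [h1]
    -- The series sums to `(1 + 1/2)^(-(k+2))`, the source of `4/9` and of `1/3 = (1/2)(2/3)`.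
    rw [tsum_mul_left, tsum_choose_mul_geometric_of_norm_lt_one (k + 1)
      (show ‖(-1 / 2 : ℝ)‖ < 1 by norm_num)]
    have e : (1 / 3 : ℝ) ^ k * (3 / 2) ^ k = (1 / 2) ^ k := by rw [← mul_pow]; norm_num
    have hp : (3 / 2 : ℝ) ^ k ≠ 0 := by positivity
    rw [show (1 - -1 / 2 : ℝ) = 3 / 2 by norm_num, ← e]
    field_simp
    ring
  simp_rw [heq]
  rw [hlim]
  refine tendsto_tsum_of_dominated_convergence
    (bound := fun j : ℕ => (k + 1) * (1 / 2) ^ k * ((j + (k + 1)).choose (k + 1) * (1 / 2) ^ j))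
    ?_ ?_ ?_
  · exact (summable_choose_mul_geometric_of_norm_lt_one (k + 1)
      (show ‖(1 / 2 : ℝ)‖ < 1 by norm_num)).mul_left _
  · intro j
    exact (tendsto_prod_ratio (k + j)).const_mul _ |>.const_mul _
  · filter_upwards with n j
    obtain ⟨h0, h1⟩ := prod_ratio_nonneg_le (k + j) n
    rw [norm_mul, norm_mul, norm_pow, norm_neg, norm_one, one_pow, one_mul, Real.norm_natCast,
      Real.norm_of_nonneg (by positivity)]
    calc ((k + j).choose k : ℝ) * ((((k + j : ℕ) : ℝ) + 1) * _)
        ≤ ((k + j).choose k : ℝ) * ((((k + j : ℕ) : ℝ) + 1) * (1 / 2) ^ (k + j)) := by gcongr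
      _ = _ := by
        rw [pow_add]
        linear_combination (1 / 2 : ℝ) ^ k * (1 / 2) ^ j * choose_mul_add_one k j

/-! ### Geometric laws and convergence in distribution -/

theorem geometricTwoThirds_real_singleton (k : ℕ) :
    geometricTwoThirds.real {k} = (1 / 3) ^ k * (2 / 3) := by
  rw [geometricTwoThirds, geometricMeasure_real_singleton]
  · norm_num
  · intro h
    have := congrArg Subtype.val h
    norm_num at this

instance : IsProbabilityMeasure geometricTwoThirds := by
  rw [geometricTwoThirds]
  infer_instance

theorem real_add_eq_of_geometricTwoThirds {Ω : Type*} [MeasurableSpace Ω] (P : Measure Ω)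
    [IsProbabilityMeasure P] (A B : Ω → ℕ) (hA : HasLaw A geometricTwoThirds P)
    (hB : HasLaw B geometricTwoThirds P) (hAB : IndepFun A B P) (k : ℕ) :
    P.real {ω | A ω + B ω = k} = 4 / 9 * ((k : ℝ) + 1) * (1 / 3 : ℝ) ^ k := by
  have hmap := (indepFun_iff_map_prod_eq_prod_map_map hA.aemeasurable hB.aemeasurable).1 hAB
  rw [hA.map_eq, hB.map_eq] at hmap
  have hset : {ω | A ω + B ω = k} = (fun ω => (A ω, B ω)) ⁻¹'
      (Finset.HasAntidiagonal.antidiagonal k : Set (ℕ × ℕ)) := by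
    ext ω
    simp
  rw [hset, ← map_measureReal_apply_of_aemeasurable
    (hA.aemeasurable.prodMk hB.aemeasurable) (Finset.measurableSet _), hmap,
    ← sum_measureReal_singleton]
  -- All `k + 1` points of the antidiagonal carry the same mass.
  have h : ∀ p ∈ Finset.HasAntidiagonal.antidiagonal k,
      (geometricTwoThirds.prod geometricTwoThirds).real {p} = 4 / 9 * (1 / 3 : ℝ) ^ k := by
    rintro ⟨i, j⟩ hp
    rw [Finset.HasAntidiagonal.mem_antidiagonal] at hp
    rw [← Set.singleton_prod_singleton, measureReal_prod_prod, geometricTwoThirds_real_singleton,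
      geometricTwoThirds_real_singleton, ← hp, pow_add]
    ring
  rw [Finset.sum_congr rfl h, Finset.sum_const, Finset.Nat.card_antidiagonal, nsmul_eq_mul]
  push_cast
  ring

/-- Pointwise convergence of mass functions to a mass function implies weak convergence. -/
theorem tendsto_probabilityMeasure_nat {μs : ℕ → ProbabilityMeasure ℕ} {μ : ProbabilityMeasure ℕ}
    (h : ∀ k, Tendsto (fun n => (μs n : Measure ℕ).real {k}) atTop
      (nhds ((μ : Measure ℕ).real {k}))) : Tendsto μs atTop (nhds μ) := by
  -- By the portmanteau theorem it suffices to bound open sets from below; this is Fatou's lemma for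
  -- counting measure.
  refine tendsto_of_forall_isOpen_le_liminf' fun G _ => ?_
  have hG : ∀ ν : Measure ℕ, ν G = ∫⁻ k, G.indicator (fun x => ν {x}) k ∂Measure.count := by
    intro ν
    rw [lintegral_count, Measure.tsum_indicator_apply_singleton ν G (MeasurableSet.of_discrete)]
  simp_rw [hG]
  have h' : ∀ k, Tendsto (fun n => (μs n : Measure ℕ) {k}) atTop
      (nhds ((μ : Measure ℕ) {k})) := by
    intro k
    exact (ENNReal.tendsto_toReal_iff (fun _ => measure_ne_top _ _) (measure_ne_top _ _)).1 (h k)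
  calc ∫⁻ k, G.indicator (fun x => (μ : Measure ℕ) {x}) k ∂Measure.count
      = ∫⁻ k, liminf (fun n => G.indicator (fun x => (μs n : Measure ℕ) {x}) k) atTop
          ∂Measure.count := by
        refine lintegral_congr fun k => ?_
        by_cases hk : k ∈ G
        · simp only [Set.indicator_of_mem hk]
          exact (h' k).liminf_eq.symm
        · simp [Set.indicator_of_notMem hk]
    _ ≤ _ := lintegral_liminf_le fun n => measurable_of_countable _

theorem numFixedPoints_le {n : ℕ} (τ : Equiv.Perm (Fin n)) : numFixedPoints τ ≤ n := by
  calc numFixedPoints τ ≤ ∑ _i : Fin n, 1 := Finset.sum_le_sum fun i _ => by split_ifs <;> simp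
    _ = n := by simp

theorem uniformOn_Av_real {n : ℕ} {k : ℕ} (σ : Equiv.Perm (Fin k)) (m : ℕ) :
    (uniformOn (Av n σ)).real {τ | numFixedPoints τ = m} =
      (((avFinset n σ).filter fun τ => numFixedPoints τ = m).card : ℝ) / (avFinset n σ).card := by
  classical
  have h1 : Av n σ = (avFinset n σ : Set (Equiv.Perm (Fin n))) := by simp [avFinset]
  have h2 : {τ : Equiv.Perm (Fin n) | numFixedPoints τ = m} =
      ((Finset.univ.filter fun τ => numFixedPoints τ = m : Finset (Equiv.Perm (Fin n))) :
        Set (Equiv.Perm (Fin n))) := by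
    ext τ
    simp
  rw [h1, h2, measureReal_def, uniformOn_apply_finset' MeasurableSpace.measurableSet_top
    MeasurableSpace.measurableSet_top, ENNReal.toReal_div, ENNReal.toReal_natCast,
    ENNReal.toReal_natCast, Finset.inter_filter, Finset.inter_univ]

end PatternAvoidance

theorem mainTheorem5 :
    -- the sum of two independent Geometric(2/3) variables has mass function `(4/9)(k+1)(1/3)^k`
    (∀ {Ω : Type*} [MeasurableSpace Ω] (P : Measure Ω) [IsProbabilityMeasure P] (A B : Ω → ℕ),
      HasLaw A geometricTwoThirds P → HasLaw B geometricTwoThirds P → IndepFun A B P →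
      ∀ k : ℕ, P.real {ω | A ω + B ω = k} = 4 / 9 * ((k : ℝ) + 1) * (1 / 3 : ℝ) ^ k) ∧
    -- the number of fixed points converges in distribution to any `Z` with that mass function
    (∀ σ : Equiv.Perm (Fin 3), σ = p132 ∨ σ = p213 →
      ∀ {Ω : ℕ → Type*} [∀ n, MeasurableSpace (Ω n)] (P : ∀ n, Measure (Ω n))
        [∀ n, IsProbabilityMeasure (P n)] (π : ∀ n, Ω n → Equiv.Perm (Fin n)),
      (∀ n, HasLaw (π n) (uniformOn (Av n σ)) (P n)) →
      ∀ {Ω' : Type*} [MeasurableSpace Ω'] (P' : Measure Ω') [IsProbabilityMeasure P']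
        (Z : Ω' → ℕ), AEMeasurable Z P' →
      (∀ k : ℕ, P'.real {ω | Z ω = k} = 4 / 9 * ((k : ℝ) + 1) * (1 / 3 : ℝ) ^ k) →
      TendstoInDistribution (fun n ω ↦ numFixedPoints (π n ω)) atTop Z P P') := by
  refine ⟨fun P _ A B hA hB hAB k => real_add_eq_of_geometricTwoThirds P A B hA hB hAB k, ?_⟩
  intro σ hσ Ω _ P _ π hπ Ω' _ P' _ Z hZ hZmass
  have hmeas : ∀ n, AEMeasurable (fun ω => numFixedPoints (π n ω)) (P n) := fun n =>
    (show Measurable (numFixedPoints (n := n)) from fun _ _ => trivial).comp_aemeasurable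
      (hπ n).aemeasurable
  refine ⟨hmeas, hZ, tendsto_probabilityMeasure_nat fun k => ?_⟩
  have hlim : ((P'.map Z).real {k}) = 4 / 9 * ((k : ℝ) + 1) * (1 / 3 : ℝ) ^ k := by
    rw [map_measureReal_apply_of_aemeasurable hZ (measurableSet_singleton k), ← hZmass k]
    rfl
  have hlaw : ∀ n, ((P n).map fun ω => numFixedPoints (π n ω)).real {k} =
      (((avFinset n σ).filter fun τ => numFixedPoints τ = k).card : ℝ) /
        (avFinset n σ).card := by
    intro n
    rw [map_measureReal_apply_of_aemeasurable (hmeas n) (measurableSet_singleton k),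
      ← uniformOn_Av_real, ← (hπ n).map_eq,
      map_measureReal_apply_of_aemeasurable (hπ n).aemeasurable trivial]
    rfl
  have hmom : ∀ n r, ∑ τ ∈ avFinset n σ, (numFixedPoints τ).choose r = catalanPowCoeff r n := by
    rcases hσ with rfl | rfl
    · exact sum_avFinset_p132
    · exact sum_avFinset_p213
  simp only [ProbabilityMeasure.coe_mk, hlim, hlaw]
  exact tendsto_card_filter_div (fun n => avFinset n σ) (fun n τ => numFixedPoints τ)
    (fun n τ _ => numFixedPoints_le τ) hmom k
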